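/- Let $\mathcal H$ be a complex Hilbert space, $r\ge 2$, let $\rho_1,\dots,\rho_r$ be arbitrary quantum states on $\mathcal H$ (positive operators of trace one), and let $q_1,\dots,q_r>0$ be probabilities with $\sum_{i=1}^r q_i=1$. Write $\|X\|_1=\mathrm{tr}\,|X|$ with $|X|=\sqrt{X^\dagger X}$ for the trace norm and $F_{ij}=\|\sqrt{\rho_i}\sqrt{\rho_j}\|_1$ for the pairwise fidelity. Then the operators $q_i\rho_i-q_j\rho_j$ and $\sqrt{\rho_i}\sqrt{\rho_j}$ are trace class, and the numbers $$Q_{new}=\frac1r\Big(1+\sum_{1\le i<j\le r}\|q_i\rho_i-q_j\rho_j\|_1\Big),\qquad Q_2=\frac12\Big(1+\frac1{r-1}\sum_{1\le i<j\le r}\|q_i\rho_i-q_j\rho_j\|_1\Big),\qquad Q_3=1-\sum_{1\le i<j\le r}q_iq_jF_{ij}^2$$ satisfy the following. (i) $\displaystyle Q_{new}\le Q_2\le 1-\frac{1}{r-1}\,(1-Q_3)$. (ii) In the equiprobable case $q_1=\dots=q_r=\frac1r$, $\;Q_{new}\le Q_3$. -/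

import Mathlib

open scoped ENNReal InnerProductSpace ComplexOrder

namespace QuantumStates

noncomputable section

variable {H : Type*} [NormedAddCommGroup H] [InnerProductSpace ℂ H] [CompleteSpace H]

/-- The sum `∑ᵢ ⟪eᵢ, T eᵢ⟫`, in `[0, ∞]`, of a positive operator `T` over a Hilbert basis. -/
def traceAlong {ι : Type*} (b : HilbertBasis ι ℂ H) (T : H →L[ℂ] H) : ℝ≥0∞ :=
  ∑' i, ENNReal.ofReal (⟪b i, T (b i)⟫_ℂ).re

variable (H) in
/-- An index set of some Hilbert basis of `H`. -/
def basisIndex : Set H := (exists_hilbertBasis ℂ H).choose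

variable (H) in
/-- Some Hilbert basis of `H`. -/
def someBasis : HilbertBasis (basisIndex H) ℂ H :=
  (exists_hilbertBasis ℂ H).choose_spec.choose

/-- The trace `tr T ∈ [0, ∞]` of a positive bounded operator `T`, computed in some Hilbert basis.
It does not depend on the basis, see `posTrace_eq_traceAlong`. It is only ever applied to positive
operators. -/
def posTrace (T : H →L[ℂ] H) : ℝ≥0∞ := traceAlong (someBasis H) T

/-- Parseval's identity, in `[0, ∞]`. -/
theorem tsum_enorm_inner_sq {ι : Type*} (b : HilbertBasis ι ℂ H) (x : H) :
    ∑' i, ‖⟪b i, x⟫_ℂ‖ₑ ^ 2 = ‖x‖ₑ ^ 2 := by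
  have h := b.hasSum_inner_mul_inner x x
  have h2 : HasSum (fun i => ‖⟪b i, x⟫_ℂ‖ ^ 2) (‖x‖ ^ 2) := by
    have h3 := Complex.hasSum_re h
    convert h3 using 1
    · funext i
      rw [← inner_conj_symm x (b i), mul_comm, Complex.mul_conj, Complex.normSq_eq_norm_sq,
        Complex.ofReal_re]
    · rw [inner_self_eq_norm_sq_to_K]
      norm_cast
  have h4 : ∀ y : ℝ, ‖y‖ₑ ^ 2 = ENNReal.ofReal (y ^ 2) := by
    intro y
    rw [← Real.enorm_eq_ofReal (sq_nonneg y), enorm_pow]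
  have h5 : ∀ i, ‖⟪b i, x⟫_ℂ‖ₑ ^ 2 = ENNReal.ofReal (‖⟪b i, x⟫_ℂ‖ ^ 2) := by
    intro i
    rw [← h4, enorm_norm]
  simp_rw [h5]
  rw [← ENNReal.ofReal_tsum_of_nonneg (fun i => sq_nonneg _) h2.summable, h2.tsum_eq, ← h4,
    enorm_norm]

/-- The trace of a positive operator, as a square sum of its square root. -/
theorem traceAlong_eq_tsum_sqrt {ι : Type*} (b : HilbertBasis ι ℂ H) {T : H →L[ℂ] H}
    (hT : T.IsPositive) : traceAlong b T = ∑' i, ‖CFC.sqrt T (b i)‖ₑ ^ 2 := by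
  have h0 : (0 : H →L[ℂ] H) ≤ T := (ContinuousLinearMap.nonneg_iff_isPositive T).2 hT
  have hs : (CFC.sqrt T).IsPositive :=
    (ContinuousLinearMap.nonneg_iff_isPositive _).1 (CFC.sqrt_nonneg T)
  refine tsum_congr fun i => ?_
  have h1 : T (b i) = CFC.sqrt T (CFC.sqrt T (b i)) := by
    conv_lhs => rw [← CFC.sqrt_mul_sqrt_self T h0]
    rfl
  have h2 : ⟪b i, T (b i)⟫_ℂ = ⟪CFC.sqrt T (b i), CFC.sqrt T (b i)⟫_ℂ := by
    rw [h1]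
    exact (hs.isSymmetric (b i) (CFC.sqrt T (b i))).symm
  rw [h2, inner_self_eq_norm_sq_to_K, ← enorm_norm (CFC.sqrt T (b i)), ← enorm_pow,
    Real.enorm_eq_ofReal (sq_nonneg _)]
  norm_cast

/-- The trace of a positive operator does not depend on the Hilbert basis. -/
theorem traceAlong_eq_traceAlong {ι κ : Type*} (b : HilbertBasis ι ℂ H) (c : HilbertBasis κ ℂ H)
    {T : H →L[ℂ] H} (hT : T.IsPositive) : traceAlong b T = traceAlong c T := by
  have hs : (CFC.sqrt T).IsPositive :=
    (ContinuousLinearMap.nonneg_iff_isPositive _).1 (CFC.sqrt_nonneg T)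
  rw [traceAlong_eq_tsum_sqrt b hT, traceAlong_eq_tsum_sqrt c hT]
  simp_rw [← tsum_enorm_inner_sq c (CFC.sqrt T (b _))]
  rw [ENNReal.tsum_comm]
  refine tsum_congr fun j => ?_
  rw [← tsum_enorm_inner_sq b (CFC.sqrt T (c j))]
  refine tsum_congr fun i => ?_
  have h : ⟪c j, CFC.sqrt T (b i)⟫_ℂ = ⟪CFC.sqrt T (c j), b i⟫_ℂ :=
    (hs.isSymmetric (c j) (b i)).symm
  rw [h, ← inner_conj_symm, ← ofReal_norm, RCLike.norm_conj, ofReal_norm]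

theorem posTrace_eq_traceAlong {ι : Type*} (b : HilbertBasis ι ℂ H) {T : H →L[ℂ] H}
    (hT : T.IsPositive) : posTrace T = traceAlong b T :=
  traceAlong_eq_traceAlong _ b hT

/-- A bounded operator `X` is trace class if `tr |X| < ∞`, where `|X| = √(X† X)`. -/
def IsTraceClass (X : H →L[ℂ] H) : Prop := posTrace (CFC.abs X) < ∞

/-- The trace norm `‖X‖₁ = tr |X|` of a trace class operator `X`. -/
def traceNorm (X : H →L[ℂ] H) : ℝ := (posTrace (CFC.abs X)).toReal

/-- A quantum state (density operator): a positive operator with trace one. -/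
structure IsState (ρ : H →L[ℂ] H) : Prop where
  isPositive : ρ.IsPositive
  trace_eq_one : posTrace ρ = 1

/-- The fidelity `F(ρ, σ) = ‖√ρ √σ‖₁`. -/
def fidelity (ρ σ : H →L[ℂ] H) : ℝ := traceNorm (CFC.sqrt ρ * CFC.sqrt σ)

variable {r : ℕ}

/-- `∑_{i < j} ‖qᵢ ρᵢ - qⱼ ρⱼ‖₁` -/
def pairSum (q : Fin r → ℝ) (ρ : Fin r → H →L[ℂ] H) : ℝ :=
  ∑ i, ∑ j ∈ Finset.Ioi i, traceNorm (q i • ρ i - q j • ρ j)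

/-- The upper bound `Q_new`. -/
def Qnew (q : Fin r → ℝ) (ρ : Fin r → H →L[ℂ] H) : ℝ :=
  1 / (r : ℝ) * (1 + pairSum q ρ)

/-- The upper bound `Q₂`. -/
def Q₂ (q : Fin r → ℝ) (ρ : Fin r → H →L[ℂ] H) : ℝ :=
  1 / 2 * (1 + 1 / ((r : ℝ) - 1) * pairSum q ρ)

/-- Montanaro's upper bound `Q₃`. -/
def Q₃ (q : Fin r → ℝ) (ρ : Fin r → H →L[ℂ] H) : ℝ :=
  1 - ∑ i, ∑ j ∈ Finset.Ioi i, q i * q j * fidelity (ρ i) (ρ j) ^ 2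

end

end QuantumStates

open scoped ENNReal InnerProductSpace ComplexOrder

namespace QuantumStates

noncomputable section

variable {H : Type*} [NormedAddCommGroup H] [InnerProductSpace ℂ H] [CompleteSpace H]

/-! Everything rests on one estimate per pair, `fuchs_van_de_graaf`: with `t = ‖aρ - bσ‖₁` and `f =
abF²`, `t² + 4f ≤ (a + b)²`. Put `L = √a √ρ`, `M = √b √σ`, so that `aρ - bσ = L² - M²`, and let `P +
Q = 1` be projections separating its positive and negative parts. Then `t` is a signed sum of the
squared Hilbert–Schmidt norms of `PL`, `PM`, `QL`, `QM`, while Cauchy–Schwarz on each block bounds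
`‖LM‖₁` by the same four numbers.

The rest is scalar: `t ≤ s` and `t ≤ s - 2f` with `s = qᵢ + qⱼ ≤ 1`, or `t ≤ s - r f` for equal
weights, summed over pairs using `∑ (qᵢ + qⱼ) = r - 1`. -/

/-- The squared Hilbert–Schmidt norm, in `[0, ∞]`. -/
def hsNormSq (T : H →L[ℂ] H) : ℝ≥0∞ := ∑' i, ‖T (someBasis H i)‖ₑ ^ 2

theorem hsNormSq_adjoint (T : H →L[ℂ] H) : hsNormSq (star T) = hsNormSq T := by
  unfold hsNormSq
  simp_rw [← tsum_enorm_inner_sq (someBasis H) ((star T : H →L[ℂ] H) _),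
    ← tsum_enorm_inner_sq (someBasis H) (T _)]
  rw [ENNReal.tsum_comm]
  refine tsum_congr fun i => tsum_congr fun j => ?_
  rw [ContinuousLinearMap.star_eq_adjoint, ContinuousLinearMap.adjoint_inner_right,
    ← inner_conj_symm, ← ofReal_norm, RCLike.norm_conj, ofReal_norm]

theorem hsNormSq_mul_le_right {W : H →L[ℂ] H} (hW : ‖W‖ ≤ 1) (T : H →L[ℂ] H) :
    hsNormSq (W * T) ≤ hsNormSq T := by
  refine ENNReal.tsum_le_tsum fun i => ?_
  gcongr
  exact enorm_le_iff_norm_le.2 (W.le_of_opNorm_le hW _ |>.trans_eq (one_mul _))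

theorem hsNormSq_mul_le_left (T : H →L[ℂ] H) {W : H →L[ℂ] H} (hW : ‖W‖ ≤ 1) :
    hsNormSq (T * W) ≤ hsNormSq T := by
  rw [← hsNormSq_adjoint, star_mul, ← hsNormSq_adjoint T]
  exact hsNormSq_mul_le_right (by rwa [norm_star]) _

theorem enorm_sq_eq_ofReal {E : Type*} [NormedAddCommGroup E] (x : E) :
    ‖x‖ₑ ^ 2 = ENNReal.ofReal (‖x‖ ^ 2) := by
  rw [ENNReal.ofReal_pow (norm_nonneg x), ofReal_norm]

theorem hasSum_hsNormSq {T : H →L[ℂ] H} (hT : hsNormSq T ≠ ∞) :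
    HasSum (fun i => ‖T (someBasis H i)‖ ^ 2) (hsNormSq T).toReal := by
  have h := ENNReal.hasSum_toReal hT
  rw [← ENNReal.tsum_toReal_eq fun i => by finiteness] at h
  simpa [hsNormSq] using h

theorem sum_norm_sq_le_hsNormSq {T : H →L[ℂ] H} (hT : hsNormSq T ≠ ∞)
    (s : Finset (basisIndex H)) :
    ∑ i ∈ s, ‖T (someBasis H i)‖ ^ 2 ≤ (hsNormSq T).toReal :=
  sum_le_hasSum s (fun _ _ => sq_nonneg _) (hasSum_hsNormSq hT)

theorem hsNormSq_starProjection_add (K : Submodule ℂ H) [K.HasOrthogonalProjection]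
    (T : H →L[ℂ] H) :
    hsNormSq (K.starProjection * T) + hsNormSq (Kᗮ.starProjection * T) = hsNormSq T := by
  unfold hsNormSq
  rw [← ENNReal.tsum_add]
  refine tsum_congr fun i => ?_
  rw [enorm_sq_eq_ofReal, enorm_sq_eq_ofReal, enorm_sq_eq_ofReal,
    ← ENNReal.ofReal_add (sq_nonneg _) (sq_nonneg _)]
  congr 1
  exact (Submodule.norm_sq_eq_add_norm_sq_starProjection (T (someBasis H i)) K).symm

theorem sum_norm_mul_norm_le_sqrt_hsNormSq {S T : H →L[ℂ] H} (hS : hsNormSq S ≠ ∞)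
    (hT : hsNormSq T ≠ ∞) (s : Finset (basisIndex H)) :
    ∑ i ∈ s, ‖S (someBasis H i)‖ * ‖T (someBasis H i)‖ ≤
      √(hsNormSq S).toReal * √(hsNormSq T).toReal := by
  refine (Real.sum_mul_le_sqrt_mul_sqrt s _ _).trans ?_
  gcongr
  · exact sum_norm_sq_le_hsNormSq hS s
  · exact sum_norm_sq_le_hsNormSq hT s

/-! ### Trace norms by testing against contractions -/

/-- An approximate inverse of a positive operator. -/
theorem exists_approx_inverse {T : H →L[ℂ] H} (hT : 0 ≤ T) {ε : ℝ} (hε : 0 < ε) :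
    ∃ G : H →L[ℂ] H, IsSelfAdjoint G ∧ ‖T * G‖ ≤ 1 ∧ ‖T - G * (T * T)‖ ≤ ε := by
  have hsa : IsSelfAdjoint T := hT.isSelfAdjoint
  have hpos : ∀ x : ℝ, 0 < |x| + ε := fun x => by positivity
  have hc : Continuous fun x : ℝ => (|x| + ε)⁻¹ :=
    (continuous_abs.add continuous_const).inv₀ fun x => (hpos x).ne'
  have hid : cfc (fun x : ℝ => x) T = T := cfc_id' ℝ T
  -- The absolute value keeps the function continuous on all of `ℝ`; on the spectrum it is `1 / (x +
  -- ε)`.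
  refine ⟨cfc (fun x : ℝ => (|x| + ε)⁻¹) T, cfc_predicate _ T, ?_, ?_⟩
  · have h : T * cfc (fun x : ℝ => (|x| + ε)⁻¹) T = cfc (fun x : ℝ => x * (|x| + ε)⁻¹) T := by
      rw [cfc_mul (fun x : ℝ => x) _ T (by fun_prop) hc.continuousOn, hid]
    rw [h]
    refine norm_cfc_le zero_le_one fun x _ => ?_
    rw [norm_mul, norm_inv, Real.norm_eq_abs, Real.norm_eq_abs, abs_of_pos (hpos x),
      ← div_eq_mul_inv, div_le_one (hpos x)]
    linarith
  · have h : T - cfc (fun x : ℝ => (|x| + ε)⁻¹) T * (T * T)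
        = cfc (fun x : ℝ => x - (|x| + ε)⁻¹ * (x * x)) T := by
      rw [cfc_sub (fun x : ℝ => x) (fun x : ℝ => (|x| + ε)⁻¹ * (x * x)) T (by fun_prop)
          (hc.mul (by fun_prop)).continuousOn,
        cfc_mul (fun x : ℝ => (|x| + ε)⁻¹) (fun x : ℝ => x * x) T hc.continuousOn (by fun_prop),
        cfc_mul (fun x : ℝ => x) (fun x : ℝ => x) T, hid]
    rw [h]
    refine norm_cfc_le hε.le fun x hx => ?_
    have hx0 : 0 ≤ x := spectrum_nonneg_of_nonneg hT hx
    rw [abs_of_nonneg hx0]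
    have hxe : 0 < x + ε := by positivity
    have h1 : x - (x + ε)⁻¹ * (x * x) = ε * (x / (x + ε)) := by
      field_simp
      ring
    rw [h1, Real.norm_of_nonneg (by positivity)]
    exact mul_le_of_le_one_right hε.le ((div_le_one hxe).2 (by linarith))

theorem posTrace_eq_tsum (T : H →L[ℂ] H) :
    posTrace T = ∑' i, ENNReal.ofReal (⟪someBasis H i, T (someBasis H i)⟫_ℂ).re := rfl

theorem re_inner_abs_nonneg (X : H →L[ℂ] H) (x : H) : 0 ≤ (⟪x, CFC.abs X x⟫_ℂ).re :=
  ((ContinuousLinearMap.nonneg_iff_isPositive _).1 (CFC.abs_nonneg X)).re_inner_nonneg_right x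

/-- The variational upper bound on the trace norm. -/
theorem posTrace_abs_le {X : H →L[ℂ] H} {c : ℝ}
    (h : ∀ W : H →L[ℂ] H, ‖W‖ ≤ 1 → ∀ s : Finset (basisIndex H),
      ∑ i ∈ s, (⟪W (someBasis H i), X (someBasis H i)⟫_ℂ).re ≤ c) :
    posTrace (CFC.abs X) ≤ ENNReal.ofReal c := by
  rw [posTrace_eq_tsum]
  refine ENNReal.summable.tsum_le_of_sum_le fun s => ?_
  rw [← ENNReal.ofReal_sum_of_nonneg fun i _ => re_inner_abs_nonneg X _]
  refine ENNReal.ofReal_le_ofReal (le_of_forall_pos_le_add fun δ hδ => ?_)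
  -- Each basis vector in `s` costs `ε`; the `+ 1` covers empty `s`.
  set ε := δ / (s.card + 1) with hεdef
  have hε : 0 < ε := by positivity
  obtain ⟨G, hG, hG1, hG2⟩ := exists_approx_inverse (CFC.abs_nonneg X) hε
  have hXX : star X * X = CFC.abs X * CFC.abs X := (CFC.abs_mul_abs X).symm
  -- `X G` replaces the partial isometry of the polar decomposition; the C⋆-identity gives `‖X G‖ =
  -- ‖|X| G‖`.
  have hW : ‖X * G‖ ≤ 1 := by
    have h1 : ‖X * G‖ * ‖X * G‖ = ‖CFC.abs X * G‖ * ‖CFC.abs X * G‖ := by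
      rw [← CStarRing.norm_star_mul_self, ← CStarRing.norm_star_mul_self, star_mul, star_mul,
        (CFC.abs_nonneg X).isSelfAdjoint.star_eq, mul_assoc, mul_assoc, ← mul_assoc _ X G,
        ← mul_assoc _ (CFC.abs X) G, hXX]
    rw [(mul_self_inj (norm_nonneg _) (norm_nonneg _)).1 h1]
    exact hG1
  have hterm : ∀ i ∈ s, (⟪someBasis H i, CFC.abs X (someBasis H i)⟫_ℂ).re ≤
      (⟪(X * G) (someBasis H i), X (someBasis H i)⟫_ℂ).re + ε := by
    intro i _
    have h1 : ⟪(X * G) (someBasis H i), X (someBasis H i)⟫_ℂ =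
        ⟪someBasis H i, (G * (CFC.abs X * CFC.abs X)) (someBasis H i)⟫_ℂ := by
      rw [← hXX]
      simp only [mul_apply_eq_comp, ContinuousLinearMap.star_eq_adjoint]
      rw [← ContinuousLinearMap.adjoint_inner_right]
      exact hG.isSymmetric _ _
    have h2 : (⟪someBasis H i, (CFC.abs X - G * (CFC.abs X * CFC.abs X)) (someBasis H i)⟫_ℂ).re
        ≤ ε := by
      refine (Complex.re_le_norm _).trans ((norm_inner_le_norm _ _).trans ?_)
      have h3 := (CFC.abs X - G * (CFC.abs X * CFC.abs X)).le_of_opNorm_le hG2 (someBasis H i)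
      rw [(someBasis H).orthonormal.1 i] at h3 ⊢
      linarith
    rw [sub_apply, inner_sub_right, Complex.sub_re] at h2
    rw [h1]
    linarith
  refine (Finset.sum_le_sum hterm).trans ?_
  rw [Finset.sum_add_distrib, Finset.sum_const, nsmul_eq_mul]
  refine add_le_add (h _ hW s) ?_
  rw [hεdef, mul_div_assoc', div_le_iff₀ (by positivity)]
  nlinarith

/-- A Cauchy–Schwarz bound on `‖L M‖₁`, split along a subspace. -/
theorem posTrace_abs_mul_le {L M : H →L[ℂ] H} (hL : IsSelfAdjoint L)
    (hLf : hsNormSq L ≠ ∞) (hMf : hsNormSq M ≠ ∞) (K : Submodule ℂ H)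
    [K.HasOrthogonalProjection] :
    posTrace (CFC.abs (L * M)) ≤ ENNReal.ofReal
      (√(hsNormSq (K.starProjection * L)).toReal * √(hsNormSq (K.starProjection * M)).toReal +
        √(hsNormSq (Kᗮ.starProjection * L)).toReal *
          √(hsNormSq (Kᗮ.starProjection * M)).toReal) := by
  have hle : ∀ (E : Submodule ℂ H) [E.HasOrthogonalProjection] (T : H →L[ℂ] H),
      hsNormSq T ≠ ∞ → hsNormSq (E.starProjection * T) ≠ ∞ := fun E _ T hT =>
    ne_top_of_le_ne_top hT (hsNormSq_mul_le_right E.starProjection_norm_le T)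
  refine posTrace_abs_le fun W hW s => ?_
  have key : ∀ (E : Submodule ℂ H) [E.HasOrthogonalProjection],
      ∑ i ∈ s, ‖(E.starProjection * L * W) (someBasis H i)‖ *
        ‖(E.starProjection * M) (someBasis H i)‖ ≤
      √(hsNormSq (E.starProjection * L)).toReal * √(hsNormSq (E.starProjection * M)).toReal := by
    intro E _
    have hlf := hle E L hLf
    have h1 := hsNormSq_mul_le_left (E.starProjection * L) hW
    refine (sum_norm_mul_norm_le_sqrt_hsNormSq (ne_top_of_le_ne_top hlf h1) (hle E M hMf) s).trans ?_
    gcongr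
  refine le_trans ?_ (add_le_add (key K) (key Kᗮ))
  rw [← Finset.sum_add_distrib]
  refine Finset.sum_le_sum fun i _ => ?_
  set e := someBasis H i
  have h1 : ⟪W e, (L * M) e⟫_ℂ =
      ⟪(K.starProjection * L * W) e, (K.starProjection * M) e⟫_ℂ +
        ⟪(Kᗮ.starProjection * L * W) e, (Kᗮ.starProjection * M) e⟫_ℂ := by
    simp only [mul_apply_eq_comp]
    have h2 : ∀ (E : Submodule ℂ H) [E.HasOrthogonalProjection] (x y : H),
        ⟪E.starProjection x, E.starProjection y⟫_ℂ = ⟪x, E.starProjection y⟫_ℂ := by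
      intro E _ x y
      rw [E.inner_starProjection_left_eq_right, E.starProjection_eq_self_iff.2
        (E.starProjection_apply_mem y)]
    rw [h2, h2, ← inner_add_right, K.starProjection_add_starProjection_orthogonal]
    exact (hL.isSymmetric _ _).symm
  rw [h1, Complex.add_re]
  exact add_le_add ((Complex.re_le_norm _).trans (norm_inner_le_norm _ _))
    ((Complex.re_le_norm _).trans (norm_inner_le_norm _ _))

/-! ### Positive and negative parts, and the pairwise estimate -/

/-- The absolute value of a selfadjoint operator, in terms of compressions to the kernel of the
negative part and to its orthogonal complement. -/
theorem exists_abs_eq_compressions {D : H →L[ℂ] H} (hD : IsSelfAdjoint D) :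
    ∃ (K : Submodule ℂ H) (_ : K.HasOrthogonalProjection),
      CFC.abs D = K.starProjection * D * K.starProjection -
        Kᗮ.starProjection * D * Kᗮ.starProjection := by
  let K : Submodule ℂ H := (D⁻ : H →L[ℂ] H).ker
  have hK : CompleteSpace K := (D⁻ : H →L[ℂ] H).isClosed_ker.completeSpace_coe
  have hKP : K.HasOrthogonalProjection := inferInstance
  refine ⟨K, hKP, ?_⟩
  have hPs : star K.starProjection = K.starProjection :=
    (isSelfAdjoint_starProjection K).star_eq
  have hp : star (D⁺ : H →L[ℂ] H) = D⁺ := (CFC.posPart_nonneg D).isSelfAdjoint.star_eq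
  have hn : star (D⁻ : H →L[ℂ] H) = D⁻ := (CFC.negPart_nonneg D).isSelfAdjoint.star_eq
  -- The range of `D⁺` lies in `K = ker D⁻` because `D⁻ D⁺ = 0`.
  have h1 : K.starProjection * D⁺ = D⁺ := by
    ext x
    refine K.starProjection_eq_self_iff.2 ?_
    change (D⁻ * D⁺ : H →L[ℂ] H) x = 0
    simp
  have h2 : D⁻ * K.starProjection = 0 := by
    ext x
    exact K.starProjection_apply_mem x
  have h3 : D⁺ * K.starProjection = D⁺ := by
    simpa [star_mul, hPs, hp] using congrArg star h1
  have h4 : K.starProjection * D⁻ = 0 := by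
    simpa [star_mul, hPs, hn] using congrArg star h2
  have hQ : Kᗮ.starProjection = 1 - K.starProjection := K.starProjection_orthogonal'
  rw [hQ, ← CFC.posPart_add_negPart D hD]
  conv_rhs => rw [← CFC.posPart_sub_negPart D hD]
  simp only [mul_sub, sub_mul, mul_one, one_mul, h1, h2, h3, h4]
  abel

/-- Let `a, b, c, d` be the squared Hilbert–Schmidt norms of `PL, PM, QL, QM`. The first trace norm
is `(a + d) - (b + c)`, the right side is the square of `(a + d) + (b + c)`, and their squares
differ by `4(a + d)(b + c)`, which dominates `4(√a√b + √c√d)²`. -/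
theorem traceNorm_sq_add_four_mul_le {L M : H →L[ℂ] H} (hL : IsSelfAdjoint L)
    (hM : IsSelfAdjoint M) (hLf : hsNormSq L ≠ ∞) (hMf : hsNormSq M ≠ ∞) :
    IsTraceClass (L * L - M * M) ∧ IsTraceClass (L * M) ∧
      traceNorm (L * L - M * M) ^ 2 + 4 * traceNorm (L * M) ^ 2 ≤
        ((hsNormSq L).toReal + (hsNormSq M).toReal) ^ 2 := by
  have hD : IsSelfAdjoint (L * L - M * M) := by
    refine IsSelfAdjoint.sub ?_ ?_ <;> rw [IsSelfAdjoint, star_mul]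
    · rw [hL.star_eq]
    · rw [hM.star_eq]
  obtain ⟨K, hK, hKD⟩ := exists_abs_eq_compressions hD
  have hle : ∀ (E : Submodule ℂ H) [E.HasOrthogonalProjection] (T : H →L[ℂ] H),
      hsNormSq T ≠ ∞ → hsNormSq (E.starProjection * T) ≠ ∞ := fun E _ T hT =>
    ne_top_of_le_ne_top hT (hsNormSq_mul_le_right E.starProjection_norm_le T)
  have hcomm : ∀ (E : Submodule ℂ H) [E.HasOrthogonalProjection] (T : H →L[ℂ] H),
      IsSelfAdjoint T → hsNormSq (T * E.starProjection) = hsNormSq (E.starProjection * T) := by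
    intro E _ T hT
    rw [← hsNormSq_adjoint, star_mul, hT.star_eq, (isSelfAdjoint_starProjection E).star_eq]
  have hsum : ∀ (E : Submodule ℂ H) [E.HasOrthogonalProjection] (T : H →L[ℂ] H),
      IsSelfAdjoint T → hsNormSq T ≠ ∞ →
      HasSum (fun i => ‖T (E.starProjection (someBasis H i))‖ ^ 2)
        (hsNormSq (E.starProjection * T)).toReal := by
    intro E _ T hT hTf
    have h := hasSum_hsNormSq (T := T * E.starProjection) (by rw [hcomm E T hT]; exact hle E T hTf)
    rwa [hcomm E T hT] at h
  have hsplit : ∀ T : H →L[ℂ] H, hsNormSq T ≠ ∞ → (hsNormSq T).toReal =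
      (hsNormSq (K.starProjection * T)).toReal + (hsNormSq (Kᗮ.starProjection * T)).toReal := by
    intro T hT
    rw [← ENNReal.toReal_add (hle K T hT) (hle Kᗮ T hT), hsNormSq_starProjection_add]
  have hquad : ∀ (E : Submodule ℂ H) [E.HasOrthogonalProjection] (T : H →L[ℂ] H) (x : H),
      IsSelfAdjoint T → (⟪x, (E.starProjection * (T * T) * E.starProjection) x⟫_ℂ).re =
        ‖T (E.starProjection x)‖ ^ 2 := by
    intro E _ T x hT
    simp only [mul_apply_eq_comp]
    rw [← E.inner_starProjection_left_eq_right]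
    have h := hT.isSymmetric (E.starProjection x) (T (E.starProjection x))
    simp only [ContinuousLinearMap.coe_coe] at h
    rw [← h, inner_self_eq_norm_sq_to_K]
    norm_cast
  have htr : HasSum (fun i => (⟪someBasis H i,
      CFC.abs (L * L - M * M) (someBasis H i)⟫_ℂ).re)
      ((hsNormSq (K.starProjection * L)).toReal - (hsNormSq (K.starProjection * M)).toReal -
        ((hsNormSq (Kᗮ.starProjection * L)).toReal -
          (hsNormSq (Kᗮ.starProjection * M)).toReal)) := by
    have h := ((hsum K L hL hLf).sub (hsum K M hM hMf)).sub
      ((hsum Kᗮ L hL hLf).sub (hsum Kᗮ M hM hMf))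
    refine h.congr_fun ?_
    intro i
    rw [hKD]
    simp only [mul_sub, sub_mul, sub_apply, inner_sub_right, Complex.sub_re]
    rw [hquad K L _ hL, hquad K M _ hM, hquad Kᗮ L _ hL, hquad Kᗮ M _ hM]
  have hpt : posTrace (CFC.abs (L * L - M * M)) = ENNReal.ofReal
      ((hsNormSq (K.starProjection * L)).toReal - (hsNormSq (K.starProjection * M)).toReal -
        ((hsNormSq (Kᗮ.starProjection * L)).toReal -
          (hsNormSq (Kᗮ.starProjection * M)).toReal)) := by
    rw [posTrace_eq_tsum, ← htr.tsum_eq, ENNReal.ofReal_tsum_of_nonneg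
      (fun i => re_inner_abs_nonneg _ _) htr.summable]
  have hnn := htr.nonneg fun i => re_inner_abs_nonneg _ _
  have hF := posTrace_abs_mul_le hL hLf hMf K
  refine ⟨?_, hF.trans_lt ENNReal.ofReal_lt_top, ?_⟩
  · rw [IsTraceClass, hpt]
    exact ENNReal.ofReal_lt_top
  have hF' : traceNorm (L * M) ≤ _ := ENNReal.toReal_le_of_le_ofReal (by positivity) hF
  have hF0 : 0 ≤ traceNorm (L * M) := ENNReal.toReal_nonneg
  rw [hsplit L hLf, hsplit M hMf, traceNorm, hpt, ENNReal.toReal_ofReal hnn]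
  have hp := ENNReal.toReal_nonneg (a := hsNormSq (K.starProjection * L))
  have hp' := ENNReal.toReal_nonneg (a := hsNormSq (K.starProjection * M))
  have hn := ENNReal.toReal_nonneg (a := hsNormSq (Kᗮ.starProjection * L))
  have hn' := ENNReal.toReal_nonneg (a := hsNormSq (Kᗮ.starProjection * M))
  generalize (hsNormSq (K.starProjection * L)).toReal = a at *
  generalize (hsNormSq (K.starProjection * M)).toReal = b at *
  generalize (hsNormSq (Kᗮ.starProjection * L)).toReal = c at *
  generalize (hsNormSq (Kᗮ.starProjection * M)).toReal = d at *
  have hsq : traceNorm (L * M) ^ 2 ≤ (√a * √b + √c * √d) ^ 2 := by gcongr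
  have hcs : (√a * √b + √c * √d) ^ 2 ≤ (a + d) * (b + c) := by
    rw [← Real.sq_sqrt hp, ← Real.sq_sqrt hp', ← Real.sq_sqrt hn, ← Real.sq_sqrt hn']
    simp only [Real.sqrt_sq (Real.sqrt_nonneg _)]
    -- The two sides differ by exactly this square.
    nlinarith [sq_nonneg (√a * √c - √b * √d)]
  nlinarith

/-! ### Scaling, and weighted square roots of states -/

theorem posTrace_smul (c : ℝ) (hc : 0 ≤ c) (T : H →L[ℂ] H) :
    posTrace (c • T) = ENNReal.ofReal c * posTrace T := by
  rw [posTrace_eq_tsum, posTrace_eq_tsum, ← ENNReal.tsum_mul_left]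
  refine tsum_congr fun i => ?_
  rw [← ENNReal.ofReal_mul hc, smul_apply, ← Complex.coe_smul,
    inner_smul_right, Complex.re_ofReal_mul]

theorem abs_smul_of_nonneg (c : ℝ) (hc : 0 ≤ c) (T : H →L[ℂ] H) :
    CFC.abs (c • T) = c • CFC.abs T := by
  rw [CFC.abs_smul, Real.norm_of_nonneg hc]

theorem traceNorm_smul (c : ℝ) (hc : 0 ≤ c) (T : H →L[ℂ] H) :
    traceNorm (c • T) = c * traceNorm T := by
  rw [traceNorm, traceNorm, abs_smul_of_nonneg c hc, posTrace_smul c hc, ENNReal.toReal_mul,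
    ENNReal.toReal_ofReal hc]

theorem hsNormSq_smul_sqrt {ρ : H →L[ℂ] H} (hρ : IsState ρ) {c : ℝ} (hc : 0 ≤ c) :
    hsNormSq (√c • CFC.sqrt ρ) = ENNReal.ofReal c := by
  have h : hsNormSq (CFC.sqrt ρ) = 1 := by
    rw [← hρ.trace_eq_one]
    exact (traceAlong_eq_tsum_sqrt _ hρ.isPositive).symm
  have h2 : ∀ i, ‖(√c • CFC.sqrt ρ) (someBasis H i)‖ₑ ^ 2 =
      ENNReal.ofReal c * ‖CFC.sqrt ρ (someBasis H i)‖ₑ ^ 2 := by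
    intro i
    rw [smul_apply, enorm_smul, mul_pow, enorm_sq_eq_ofReal,
      Real.norm_of_nonneg (Real.sqrt_nonneg c), Real.sq_sqrt hc]
  rw [hsNormSq, tsum_congr h2, ENNReal.tsum_mul_left]
  exact (congrArg (ENNReal.ofReal c * ·) h).trans (mul_one _)

theorem isSelfAdjoint_smul_sqrt (c : ℝ) (ρ : H →L[ℂ] H) : IsSelfAdjoint (c • CFC.sqrt ρ) :=
  (IsSelfAdjoint.all c).smul (CFC.sqrt_nonneg ρ).isSelfAdjoint

theorem smul_sqrt_mul_self {ρ : H →L[ℂ] H} (hρ : IsState ρ) {c : ℝ} (hc : 0 ≤ c) :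
    (√c • CFC.sqrt ρ) * (√c • CFC.sqrt ρ) = c • ρ := by
  rw [smul_mul_smul_comm, Real.mul_self_sqrt hc, CFC.sqrt_mul_sqrt_self ρ
    ((ContinuousLinearMap.nonneg_iff_isPositive ρ).2 hρ.isPositive)]

/-- The Fuchs–van de Graaf inequality `‖a ρ - b σ‖₁² + 4 a b F(ρ, σ)² ≤ (a + b)²`. -/
theorem fuchs_van_de_graaf {ρ σ : H →L[ℂ] H} (hρ : IsState ρ) (hσ : IsState σ) {a b : ℝ}
    (ha : 0 ≤ a) (hb : 0 ≤ b) :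
    IsTraceClass (a • ρ - b • σ) ∧
      traceNorm (a • ρ - b • σ) ^ 2 + 4 * (a * b * fidelity ρ σ ^ 2) ≤ (a + b) ^ 2 := by
  have h := traceNorm_sq_add_four_mul_le (isSelfAdjoint_smul_sqrt (√a) ρ)
    (isSelfAdjoint_smul_sqrt (√b) σ) (by rw [hsNormSq_smul_sqrt hρ ha]; exact ENNReal.ofReal_ne_top)
    (by rw [hsNormSq_smul_sqrt hσ hb]; exact ENNReal.ofReal_ne_top)
  rw [hsNormSq_smul_sqrt hρ ha, hsNormSq_smul_sqrt hσ hb, smul_sqrt_mul_self hρ ha,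
    smul_sqrt_mul_self hσ hb, ENNReal.toReal_ofReal ha, ENNReal.toReal_ofReal hb,
    smul_mul_smul_comm, traceNorm_smul _ (by positivity), mul_pow, mul_pow, Real.sq_sqrt ha,
    Real.sq_sqrt hb] at h
  exact ⟨h.1, h.2.2⟩

theorem isTraceClass_sqrt_mul_sqrt {ρ σ : H →L[ℂ] H} (hρ : IsState ρ) (hσ : IsState σ) :
    IsTraceClass (CFC.sqrt ρ * CFC.sqrt σ) := by
  have h1 := hsNormSq_smul_sqrt hρ zero_le_one
  have h2 := hsNormSq_smul_sqrt hσ zero_le_one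
  rw [Real.sqrt_one, one_smul] at h1 h2
  exact (traceNorm_sq_add_four_mul_le (CFC.sqrt_nonneg ρ).isSelfAdjoint
    (CFC.sqrt_nonneg σ).isSelfAdjoint (by simp [h1]) (by simp [h2])).2.1

/-! ### Sums over pairs and the final bounds -/

/-- Each index lies in `r - 1` pairs. -/
theorem sum_Ioi_add {r : ℕ} (q : Fin r → ℝ) :
    ∑ i, ∑ j ∈ Finset.Ioi i, (q i + q j) = ((r : ℝ) - 1) * ∑ i, q i := by
  refine (Finset.sum_congr rfl fun i _ => Finset.sum_congr rfl fun j _ => add_comm _ _).trans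
    ((Finset.sum_sum_Ioi_add_eq_sum_sum_off_diag fun i _ => q i).trans ?_)
  have h : ∀ i, ∑ j ∈ ({i}ᶜ : Finset (Fin r)), q j = ∑ j, q j - q i := by
    intro i
    rw [eq_sub_iff_add_eq, add_comm, ← Finset.sum_singleton q i, Finset.sum_add_sum_compl]
  simp only [h, Finset.sum_sub_distrib, Finset.sum_const, Finset.card_univ, Fintype.card_fin,
    nsmul_eq_mul]
  ring

theorem sum_Ioi_le_sum_Ioi {r : ℕ} {f g : Fin r → Fin r → ℝ} (h : ∀ i j, i ≠ j → f i j ≤ g i j) :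
    ∑ i, ∑ j ∈ Finset.Ioi i, f i j ≤ ∑ i, ∑ j ∈ Finset.Ioi i, g i j :=
  Finset.sum_le_sum fun i _ => Finset.sum_le_sum fun j hj => h i j (Finset.mem_Ioi.1 hj).ne

theorem add_le_one_of_sum_eq_one {r : ℕ} {q : Fin r → ℝ} (hq : ∀ i, 0 < q i)
    (hq1 : ∑ i, q i = 1) {i j : Fin r} (hij : i ≠ j) : q i + q j ≤ 1 := by
  rw [← hq1, ← Finset.sum_pair hij]
  exact Finset.sum_le_sum_of_subset_of_nonneg (Finset.subset_univ _) fun k _ _ => (hq k).le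

end

end QuantumStates

theorem proposition2 {H : Type*} [NormedAddCommGroup H] [InnerProductSpace ℂ H] [CompleteSpace H]
    (r : ℕ) (hr : 2 ≤ r) (ρ : Fin r → H →L[ℂ] H) (hρ : ∀ i, QuantumStates.IsState (ρ i))
    (q : Fin r → ℝ) (hq : ∀ i, 0 < q i) (hq1 : ∑ i, q i = 1) :
    -- all trace norms that enter the bounds are finite
    (∀ i j, QuantumStates.IsTraceClass (q i • ρ i - q j • ρ j)) ∧
    (∀ i j, QuantumStates.IsTraceClass (CFC.sqrt (ρ i) * CFC.sqrt (ρ j))) ∧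
    -- (i)
    QuantumStates.Qnew q ρ ≤ QuantumStates.Q₂ q ρ ∧
    QuantumStates.Q₂ q ρ ≤ 1 - 1 / ((r : ℝ) - 1) * (1 - QuantumStates.Q₃ q ρ) ∧
    -- (ii)
    ((∀ i, q i = 1 / (r : ℝ)) → QuantumStates.Qnew q ρ ≤ QuantumStates.Q₃ q ρ) := by
  have hfg := fun i j => QuantumStates.fuchs_van_de_graaf (hρ i) (hρ j) (hq i).le (hq j).le
  have hr2 : (2 : ℝ) ≤ r := by exact_mod_cast hr
  have hr1 : (0 : ℝ) < (r : ℝ) - 1 := by linarith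
  have hr0 : (0 : ℝ) < r := by linarith
  have hsum := QuantumStates.sum_Ioi_add q
  rw [hq1, mul_one] at hsum
  refine ⟨fun i j => (hfg i j).1,
    fun i j => QuantumStates.isTraceClass_sqrt_mul_sqrt (hρ i) (hρ j), ?_, ?_, fun hqr => ?_⟩
  · have hP : QuantumStates.pairSum q ρ ≤ (r : ℝ) - 1 := by
      rw [← hsum]
      refine QuantumStates.sum_Ioi_le_sum_Ioi fun i j _ => ?_
      have h1 : 0 ≤ q i * q j * QuantumStates.fidelity (ρ i) (ρ j) ^ 2 :=
        mul_nonneg (mul_pos (hq i) (hq j)).le (sq_nonneg _)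
      exact abs_le_of_sq_le_sq' (by linarith [(hfg i j).2]) (add_pos (hq i) (hq j)).le |>.2
    rw [QuantumStates.Qnew, QuantumStates.Q₂, ← sub_nonneg]
    have h : 1 / 2 * (1 + 1 / ((r : ℝ) - 1) * QuantumStates.pairSum q ρ) -
        1 / (r : ℝ) * (1 + QuantumStates.pairSum q ρ) =
        ((r : ℝ) - 2) * ((r : ℝ) - 1 - QuantumStates.pairSum q ρ) / (2 * r * ((r : ℝ) - 1)) := by
      field_simp
      ring
    rw [h]
    exact div_nonneg (mul_nonneg (by linarith) (by linarith)) (by positivity)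
  · have hP : QuantumStates.pairSum q ρ ≤ (r : ℝ) - 1 - 2 * (1 - QuantumStates.Q₃ q ρ) := by
      rw [← hsum, QuantumStates.Q₃, sub_sub_cancel, Finset.mul_sum]
      simp_rw [Finset.mul_sum]
      rw [← Finset.sum_sub_distrib]
      simp_rw [← Finset.sum_sub_distrib]
      refine QuantumStates.sum_Ioi_le_sum_Ioi fun i j hij => ?_
      have h1 : 0 ≤ q i * q j * QuantumStates.fidelity (ρ i) (ρ j) ^ 2 :=
        mul_nonneg (mul_pos (hq i) (hq j)).le (sq_nonneg _)
      have h2 := (hfg i j).2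
      have h3 := QuantumStates.add_le_one_of_sum_eq_one hq hq1 hij
      have h4 : 0 < q i + q j := add_pos (hq i) (hq j)
      generalize q i * q j * QuantumStates.fidelity (ρ i) (ρ j) ^ 2 = f at *
      generalize q i + q j = s at *
      -- `t² ≤ s² - 4f ≤ (s - 2f)²` since `s ≤ 1`, and `s - 2f ≥ 0` since `4f ≤ s² ≤ s`.
      refine abs_le_of_sq_le_sq' ?_ ?_ |>.2
      · nlinarith
      · nlinarith
    rw [QuantumStates.Q₂, ← sub_nonneg]
    have h : 1 - 1 / ((r : ℝ) - 1) * (1 - QuantumStates.Q₃ q ρ) -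
        1 / 2 * (1 + 1 / ((r : ℝ) - 1) * QuantumStates.pairSum q ρ) =
        ((r : ℝ) - 1 - 2 * (1 - QuantumStates.Q₃ q ρ) - QuantumStates.pairSum q ρ) /
          (2 * ((r : ℝ) - 1)) := by
      field_simp
      ring
    rw [h]
    exact div_nonneg (by linarith) (by positivity)
  · have hP : QuantumStates.pairSum q ρ ≤ (r : ℝ) - 1 - r * (1 - QuantumStates.Q₃ q ρ) := by
      rw [← hsum, QuantumStates.Q₃, sub_sub_cancel, Finset.mul_sum]
      simp_rw [Finset.mul_sum]
      rw [← Finset.sum_sub_distrib]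
      simp_rw [← Finset.sum_sub_distrib]
      refine QuantumStates.sum_Ioi_le_sum_Ioi fun i j _ => ?_
      have h2 := (hfg i j).2
      rw [hqr i, hqr j] at h2 ⊢
      generalize QuantumStates.traceNorm ((1 / (r : ℝ)) • ρ i - (1 / (r : ℝ)) • ρ j) = t at *
      generalize 1 / (r : ℝ) * (1 / r) * QuantumStates.fidelity (ρ i) (ρ j) ^ 2 = f at *
      obtain ⟨c, hc⟩ : ∃ c : ℝ, c = 1 / r := ⟨_, rfl⟩
      have hcr : c * r = 1 := by rw [hc]; field_simp
      have hc0 : 0 < c := by rw [hc]; positivity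
      rw [← hc] at h2 ⊢
      -- `4ct ≤ t² + 4c² ≤ 8c² - 4f`; multiplying by `r = 1/c` then gives `t + r f ≤ 2c`.
      have h5 : c * t + f ≤ c * (c + c) := by nlinarith [sq_nonneg (t - 2 * c)]
      have h6 : t + r * f = r * (c * t + f) := by linear_combination (-t) * hcr
      have h7 : c + c = r * (c * (c + c)) := by linear_combination (-(c + c)) * hcr
      have h8 := mul_le_mul_of_nonneg_left h5 hr0.le
      linarith
    rw [QuantumStates.Qnew, one_div, inv_mul_le_iff₀ hr0]
    linarith
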